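/- Let $\overline{\mathcal G}_n=\{M_1\otimes\cdots\otimes M_n : M_j\in\{I,X,Y,Z\}\}$ be the set of $n$-qubit Pauli operators, let $\mathcal G_n=\{i^e g : g\in\overline{\mathcal G}_n,\ e\in\{0,1,2,3\}\}$ be the $n$-fold Pauli group, and let the weight of $i^eM_1\otimes\cdots\otimes M_n$ be the number of $j$ with $M_j\neq I$. For a subgroup $\mathcal V\subseteq\mathcal G_n$ write $\overline{\mathcal V}=\{g\in\overline{\mathcal G}_n : i^eg\in\mathcal V\text{ for some }e\}$. A subspace $Q\subseteq\mathbb C^{2^n}$ is an $[[n,k,d]]$ stabilizer code if there is an abelian subgroup $\mathcal S\subseteq\mathcal G_n$ with $-\mathbb I\notin\mathcal S$, generated by $n-k$ independent generators, such that $Q=\{\psi\in\mathbb C^{2^n} : g\psi=\psi\ \text{for all } g\in\mathcal S\}$ and $d$ is the minimum weight of an element of $\overline{\mathcal S^{\perp}}\setminus\overline{\mathcal S}$, where $\mathcal S^{\perp}$ is the group of all elements of $\mathcal G_n$ that commute with every element of $\mathcal S$. Then: (1) there is no $[[27,15,5]]$ stabilizer code, and more precisely there is no $[[27,15,d]]$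 stabilizer code with $d\ge 5$; (2) there is no $[[28,14,6]]$ stabilizer code, and more precisely there is no $[[28,14,d]]$ stabilizer code with $d\ge 6$. Both codes may be degenerate or nondegenerate. -/

import Mathlib

open scoped Matrix

noncomputable section

/-- Linear operators on the `n`-qubit state space `(ℂ²)^{⊗ n} = ℂ^{2^n}`, written in the
computational basis, which is indexed by the bit strings `Fin n → Fin 2`. -/
abbrev QubitOp (n : ℕ) : Type := Matrix (Fin n → Fin 2) (Fin n → Fin 2) ℂ

/-- Labels of the four single-qubit Pauli matrices. -/
inductive Pauli : Type
  | I | X | Y | Z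
  deriving DecidableEq

/-- The Pauli matrices (`Y = i X Z`). -/
def Pauli.mat : Pauli → Matrix (Fin 2) (Fin 2) ℂ
  | .I => !![1, 0; 0, 1]
  | .X => !![0, 1; 1, 0]
  | .Y => !![0, -Complex.I; Complex.I, 0]
  | .Z => !![1, 0; 0, -1]

/-- The tensor product `A₁ ⊗ ⋯ ⊗ Aₙ` of single-qubit operators. -/
def tensorOp {n : ℕ} (A : Fin n → Matrix (Fin 2) (Fin 2) ℂ) : QubitOp n :=
  Matrix.of fun x y => ∏ j, A j (x j) (y j)

/-- The Pauli operator `M₁ ⊗ ⋯ ⊗ Mₙ`, where `M_j ∈ {I, X, Y, Z}` is named by `p j`. -/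
def pauliOp {n : ℕ} (p : Fin n → Pauli) : QubitOp n := tensorOp fun j => (p j).mat

/-- The weight of `M₁ ⊗ ⋯ ⊗ Mₙ`: the number of tensor factors that are not the identity. -/
def pauliWeight {n : ℕ} (p : Fin n → Pauli) : ℕ :=
  (Finset.univ.filter fun j => p j ≠ Pauli.I).card

theorem tensorOp_mul {n : ℕ} (A B : Fin n → Matrix (Fin 2) (Fin 2) ℂ) :
    tensorOp A * tensorOp B = tensorOp fun j => A j * B j := by
  ext x y
  simp only [tensorOp, Matrix.mul_apply, Matrix.of_apply, Finset.prod_univ_sum,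
    Fintype.piFinset_univ, Finset.prod_mul_distrib]

theorem tensorOp_smul {n : ℕ} (c : Fin n → ℂ) (A : Fin n → Matrix (Fin 2) (Fin 2) ℂ) :
    tensorOp (fun j => c j • A j) = (∏ j, c j) • tensorOp A := by
  ext x y
  simp [tensorOp, Finset.prod_mul_distrib]

theorem tensorOp_one {n : ℕ} : tensorOp (fun _ : Fin n => 1) = 1 := by
  ext x y
  simp only [tensorOp, Matrix.of_apply, Matrix.one_apply, Finset.prod_boole, Finset.mem_univ,
    true_implies, funext_iff]

theorem Pauli.mat_I : Pauli.I.mat = 1 := by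
  simp [Pauli.mat, Matrix.one_fin_two]

theorem Pauli.mat_mul (a b : Pauli) :
    ∃ (e : ℕ) (c : Pauli), a.mat * b.mat = Complex.I ^ e • c.mat := by
  have hI : Complex.I ^ 3 = -Complex.I := by
    rw [pow_succ, Complex.I_sq, neg_one_mul]
  cases a <;> cases b
  · exact ⟨0, .I, by simp [Pauli.mat]⟩
  · exact ⟨0, .X, by simp [Pauli.mat]⟩
  · exact ⟨0, .Y, by simp [Pauli.mat]⟩
  · exact ⟨0, .Z, by simp [Pauli.mat]⟩
  · exact ⟨0, .X, by simp [Pauli.mat]⟩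
  · exact ⟨0, .I, by simp [Pauli.mat]⟩
  · exact ⟨1, .Z, by simp [Pauli.mat]⟩
  · exact ⟨3, .Y, by simp [Pauli.mat, hI]⟩
  · exact ⟨0, .Y, by simp [Pauli.mat]⟩
  · exact ⟨3, .Z, by simp [Pauli.mat, hI]⟩
  · exact ⟨0, .I, by simp [Pauli.mat]⟩
  · exact ⟨1, .X, by simp [Pauli.mat]⟩
  · exact ⟨0, .Z, by simp [Pauli.mat]⟩
  · exact ⟨1, .Y, by simp [Pauli.mat]⟩
  · exact ⟨3, .X, by simp [Pauli.mat, hI]⟩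
  · exact ⟨0, .I, by simp [Pauli.mat]⟩

theorem Pauli.mat_mul_self (a : Pauli) : a.mat * a.mat = 1 := by
  cases a <;> simp [Pauli.mat, Matrix.one_fin_two]

theorem pauliOp_I {n : ℕ} : pauliOp (fun _ : Fin n => Pauli.I) = 1 := by
  simp only [pauliOp, Pauli.mat_I, tensorOp_one]

theorem pauliOp_mul {n : ℕ} (p q : Fin n → Pauli) :
    ∃ (e : ℕ) (r : Fin n → Pauli), pauliOp p * pauliOp q = Complex.I ^ e • pauliOp r := by
  choose e r h using fun j => Pauli.mat_mul (p j) (q j)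
  refine ⟨∑ j, e j, r, ?_⟩
  simp only [pauliOp, tensorOp_mul, h, tensorOp_smul, Finset.prod_pow_eq_pow_sum]

theorem pauliOp_mul_self {n : ℕ} (p : Fin n → Pauli) : pauliOp p * pauliOp p = 1 := by
  simp only [pauliOp, tensorOp_mul, Pauli.mat_mul_self, tensorOp_one]

/-- The `n`-fold Pauli group `𝒢ₙ`: all operators `i^e M₁ ⊗ ⋯ ⊗ Mₙ`. -/
def pauliGroup (n : ℕ) : Subgroup (QubitOp n)ˣ where
  carrier := {g | ∃ (e : ℕ) (p : Fin n → Pauli), (g : QubitOp n) = Complex.I ^ e • pauliOp p}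
  one_mem' := ⟨0, fun _ => Pauli.I, by simp [pauliOp_I]⟩
  mul_mem' := by
    rintro a b ⟨e, p, ha⟩ ⟨f, q, hb⟩
    obtain ⟨s, r, h⟩ := pauliOp_mul p q
    refine ⟨e + f + s, r, ?_⟩
    rw [Units.val_mul, ha, hb, smul_mul_smul_comm, h, smul_smul, pow_add, pow_add]
  inv_mem' := by
    rintro a ⟨e, p, ha⟩
    refine ⟨3 * e, p, ?_⟩
    refine Units.inv_eq_of_mul_eq_one_right ?_
    rw [ha, smul_mul_smul_comm, pauliOp_mul_self, ← pow_add,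
      show e + 3 * e = 4 * e by ring, pow_mul, Complex.I_pow_four, one_pow, one_smul]

/-- The phase-free part `V̄` of a Pauli subgroup `V`: the `M₁ ⊗ ⋯ ⊗ Mₙ` with
`i^e M₁ ⊗ ⋯ ⊗ Mₙ ∈ V` for some `e`. -/
def phaseFree {n : ℕ} (V : Subgroup (QubitOp n)ˣ) : Set (Fin n → Pauli) :=
  {p | ∃ g ∈ V, ∃ e : ℕ, (g : QubitOp n) = Complex.I ^ e • pauliOp p}

/-- `S^⊥`: the elements of the Pauli group that commute with every element of `S`. (Two Pauli
operators commute exactly when their symplectic inner product vanishes.) -/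
def pauliPerp {n : ℕ} (S : Subgroup (QubitOp n)ˣ) : Subgroup (QubitOp n)ˣ :=
  pauliGroup n ⊓ Subgroup.centralizer (S : Set (QubitOp n)ˣ)

/-- `S` is an abelian subgroup of the Pauli group `𝒢ₙ` that does not contain `-𝕀` and is
generated by `r` independent generators. -/
structure IsStabilizerGroup (n r : ℕ) (S : Subgroup (QubitOp n)ˣ) : Prop where
  le_pauliGroup : S ≤ pauliGroup n
  comm : ∀ g ∈ S, ∀ h ∈ S, g * h = h * g
  neg_one_notMem : (-1 : (QubitOp n)ˣ) ∉ S
  generators : ∃ g : Fin r → (QubitOp n)ˣ,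
    Subgroup.closure (Set.range g) = S ∧ ∀ i, g i ∉ Subgroup.closure (g '' {j | j ≠ i})

/-- The code space `C(S) = {ψ : g ψ = ψ for all g ∈ S}`. -/
def codeSpace {n : ℕ} (S : Subgroup (QubitOp n)ˣ) : Submodule ℂ ((Fin n → Fin 2) → ℂ) where
  carrier := {ψ | ∀ g ∈ S, (g : QubitOp n) *ᵥ ψ = ψ}
  add_mem' := by
    intro a b ha hb g hg
    rw [Matrix.mulVec_add, ha g hg, hb g hg]
  zero_mem' := by
    intro g _
    exact Matrix.mulVec_zero _
  smul_mem' := by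
    intro c a ha g hg
    rw [Matrix.mulVec_smul, ha g hg]

/-- `Q` is an `[[n, k, d]]` stabilizer code: `Q = C(S)` for a stabilizer group `S` with `n - k`
independent generators, and the minimum distance, i.e. the least weight of an element of
`S̄^⊥ \ S̄`, is exactly `d`. -/
def IsStabilizerCode (n k d : ℕ) (Q : Submodule ℂ ((Fin n → Fin 2) → ℂ)) : Prop :=
  ∃ (r : ℕ) (S : Subgroup (QubitOp n)ˣ), r + k = n ∧ IsStabilizerGroup n r S ∧
    Q = codeSpace S ∧ IsLeast (pauliWeight '' (phaseFree (pauliPerp S) \ phaseFree S)) d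

end

/-! ### Functions of bounded degree over `𝔽₂` -/

/-! Modulo phases, a stabilizer group becomes an additive code `C` of size `2 ^ (n - k)` in `SympVec
n`. It is self-orthogonal for the symplectic form, and all dual words outside `C` have weight at
least `d` (`isSelfOrthogonal_labels`). Low-weight words inside `C` are allowed, so degenerate codes
are covered.

The contradiction is linear programming on the weights of `C`. The usual inequalities are
MacWilliams with the distance bound (`sum_charSum_nonneg`) and the shadow (`sum_shadow_nonneg`).
Weight parity is additive on `C`, so either `C` is even or the signs `(-1)^wt` sum to zero; a dual
certificate excludes the latter (`IsSelfOrthogonal.even`).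

For even `C` there is a further inequality: `wt / 2` mod 2 is a cubic Boolean function, so by the
Reed–Muller distance bound at least `|C| / 8` words have weight divisible by four
(`sum_four_dvd_nonneg`). Its average over shortened codes is `sum_four_dvd_mul_nonneg`. A second
certificate then excludes even codes (`IsSelfOrthogonal.not_even`). -/

/-- The difference of a Boolean function in direction `a`. -/
def boolDiff {G : Type*} [Add G] (a : G) (f : G → ZMod 2) : G → ZMod 2 :=
  fun x => f (x + a) + f x

/-- A Boolean function has degree at most `d` if all its `(d+1)`-fold differences vanish. -/
def BoolDegLE {G : Type*} [Add G] : ℕ → (G → ZMod 2) → Prop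
  | 0, f => ∀ a, boolDiff a f = 0
  | d + 1, f => ∀ a, BoolDegLE d (boolDiff a f)

theorem card_le_two_mul_card_support_of_boolDiff {G : Type*} [AddGroup G] [Fintype G]
    (a : G) (f : G → ZMod 2) :
    (Finset.univ.filter fun x => boolDiff a f x ≠ 0).card
      ≤ 2 * (Finset.univ.filter fun x => f x ≠ 0).card := by
  classical
  have hsub : (Finset.univ.filter fun x => boolDiff a f x ≠ 0) ⊆
      (Finset.univ.filter fun x => f (x + a) ≠ 0) ∪ Finset.univ.filter fun x => f x ≠ 0 := by
    intro x hx
    have hx := (Finset.mem_filter.mp hx).2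
    simp only [Finset.mem_filter, Finset.mem_univ, true_and, Finset.mem_union]
    by_contra! h
    exact hx (by rw [boolDiff, h.1, h.2, add_zero])
  have hcard : (Finset.univ.filter fun x => f (x + a) ≠ 0).card
      = (Finset.univ.filter fun x => f x ≠ 0).card :=
    Finset.card_equiv (Equiv.addRight a) (by simp)
  calc _ ≤ _ := Finset.card_le_card hsub
    _ ≤ _ := Finset.card_union_le _ _
    _ = _ := by rw [hcard]; ring

/-- The Reed–Muller minimum distance. Some difference is nonzero unless `f` is constant;
differencing lowers the degree by one and at most doubles the support. -/
theorem BoolDegLE.card_le {G : Type*} [AddGroup G] [Fintype G] (d : ℕ) (f : G → ZMod 2)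
    (hf : BoolDegLE d f) (h0 : f ≠ 0) :
    Fintype.card G ≤ 2 ^ d * (Finset.univ.filter fun x => f x ≠ 0).card := by
  by_cases hc : ∀ a, boolDiff a f = 0
  · obtain ⟨x, hx⟩ := Function.ne_iff.mp h0
    have hconst : ∀ y, f y = f x := fun y => by
      have h := congrFun (hc (-x + y)) x
      simp only [boolDiff, add_neg_cancel_left, Pi.zero_apply] at h
      exact CharTwo.add_eq_zero.mp h
    have : (Finset.univ.filter fun y => f y ≠ 0) = Finset.univ :=
      Finset.filter_true_of_mem fun y _ => by rw [hconst y]; exact hx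
    rw [this, Finset.card_univ]
    exact Nat.le_mul_of_pos_left _ (by positivity)
  · cases d with
    | zero => exact absurd hf hc
    | succ d =>
      push Not at hc
      obtain ⟨a, ha⟩ := hc
      calc _ ≤ _ := BoolDegLE.card_le d _ (hf a) ha
        _ ≤ _ := Nat.mul_le_mul_left _ (card_le_two_mul_card_support_of_boolDiff a f)
        _ = _ := by ring

/-! ### Symplectic geometry of `(𝔽₂ × 𝔽₂)ⁿ` -/

/-- Label vectors of Pauli operators. -/
abbrev SympVec (n : ℕ) : Type := Fin n → ZMod 2 × ZMod 2

/-- The weight of a single label. -/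
def labelWt (a : ZMod 2 × ZMod 2) : ℕ := if a = 0 then 0 else 1

/-- The symplectic form on labels. -/
def labelForm (a b : ZMod 2 × ZMod 2) : ZMod 2 := a.1 * b.2 + a.2 * b.1

namespace SympVec

variable {n : ℕ}

/-- The number of nonzero labels. -/
def wt (v : SympVec n) : ℕ := ∑ j, labelWt (v j)

/-- The symplectic form. -/
def form (u v : SympVec n) : ZMod 2 := ∑ j, labelForm (u j) (v j)

theorem form_add_left (u v w : SympVec n) : form (u + v) w = form u w + form v w := by
  simp only [form, ← Finset.sum_add_distrib, labelForm, Pi.add_apply, Prod.fst_add, Prod.snd_add]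
  exact Finset.sum_congr rfl fun _ _ => by ring

theorem wt_zero : wt (0 : SympVec n) = 0 := by simp [wt, labelWt]

theorem wt_le (u : SympVec n) : wt u ≤ n := by
  calc wt u ≤ ∑ _j : Fin n, 1 := Finset.sum_le_sum fun j _ => by unfold labelWt; split_ifs <;> simp
    _ = n := by simp

theorem labelWt_add (a b : ZMod 2 × ZMod 2) :
    (labelWt (a + b) : ZMod 2) = labelWt a + labelWt b + labelForm a b := by
  revert a b; decide

/-- Parity of the weight is a quadratic form polarising to `form`, hence additive on self-orthogonal
codes. -/
theorem wt_add (u v : SympVec n) : (wt (u + v) : ZMod 2) = wt u + wt v + form u v := by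
  simp only [wt, form, Nat.cast_sum, ← Finset.sum_add_distrib, Pi.add_apply, labelWt_add]

/-- The sign `(-1)^a`. -/
def sgn (a : ZMod 2) : ℤ := if a = 0 then 1 else -1

theorem sgn_add (a b : ZMod 2) : sgn (a + b) = sgn a * sgn b := by
  revert a b; decide

theorem sum_sgn {G : Type*} [AddGroup G] [Fintype G] (φ : G → ZMod 2)
    (hφ : ∀ x y, φ (x + y) = φ x + φ y) :
    ((∀ x, φ x = 0) ∧ ∑ x, sgn (φ x) = Fintype.card G) ∨
      ((∃ x, φ x ≠ 0) ∧ ∑ x, sgn (φ x) = 0) := by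
  by_cases h : ∀ x, φ x = 0
  · exact Or.inl ⟨h, by simp [h, sgn]⟩
  · push Not at h
    refine Or.inr ⟨h, ?_⟩
    obtain ⟨a, ha⟩ := h
    -- Translation by `a` permutes the group but flips every sign.
    have h1 : ∑ x, sgn (φ (x + a)) = ∑ x, sgn (φ x) :=
      Equiv.sum_comp (Equiv.addRight a) fun x => sgn (φ x)
    simp only [hφ, sgn_add, ← Finset.sum_mul] at h1
    have h2 : sgn (φ a) = -1 := if_neg ha
    rw [h2] at h1
    linarith

/-! ### Krawtchouk transforms -/

/-- The operator `y ↦ (j ↦ y j + c * y (j + 1))`. -/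
def shiftOp (c : ℤ) (y : ℕ → ℤ) : ℕ → ℤ := fun j => y j + c * y (j + 1)

theorem shiftOp_commute (c d : ℤ) : Function.Commute (shiftOp c) (shiftOp d) := by
  intro y
  funext j
  simp only [shiftOp]
  ring

/-- The symplectic Fourier transform of the function `v ↦ y (wt v)`. -/
def charSum (y : ℕ → ℤ) (u : SympVec n) : ℤ := ∑ v : SympVec n, sgn (form u v) * y (wt v)

/-- Summing out the first coordinate: label zero contributes 1, and the three nonzero labels
together contribute 3 or -1. -/
theorem charSum_cons (y : ℕ → ℤ) (a : ZMod 2 × ZMod 2) (u : SympVec n) :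
    charSum y (Fin.cons a u : SympVec (n + 1)) =
      charSum (shiftOp (if a = 0 then 3 else -1) y) u := by
  have hlabel : ∀ (a : ZMod 2 × ZMod 2) (z : ℕ → ℤ),
      ∑ b, sgn (labelForm a b) * z (labelWt b) = z 0 + (if a = 0 then 3 else -1) * z 1 := by
    intro a z
    have hc : ∑ b, sgn (labelForm a b) * z (labelWt b)
        = (∑ b, if labelWt b = 0 then sgn (labelForm a b) else 0) * z 0
          + (∑ b, if labelWt b = 0 then 0 else sgn (labelForm a b)) * z 1 := by
      rw [Finset.sum_mul, Finset.sum_mul, ← Finset.sum_add_distrib]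
      refine Finset.sum_congr rfl fun b _ => ?_
      unfold labelWt
      split_ifs <;> simp_all
    rw [hc]
    have h0 : (∑ b, if labelWt b = 0 then sgn (labelForm a b) else 0) = 1 := by
      clear hc; revert a; decide
    have h1 : (∑ b, if labelWt b = 0 then 0 else sgn (labelForm a b))
        = if a = 0 then 3 else -1 := by
      clear hc h0; revert a; decide
    rw [h0, h1, one_mul]
  have hsplit : charSum y (Fin.cons a u : SympVec (n + 1)) =
      ∑ v : SympVec n, sgn (form u v) *
        ∑ b, sgn (labelForm a b) * y (labelWt b + wt v) := by
    unfold charSum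
    rw [← Equiv.sum_comp (Fin.consEquiv fun _ : Fin (n + 1) => ZMod 2 × ZMod 2),
      Fintype.sum_prod_type, Finset.sum_comm]
    refine Finset.sum_congr rfl fun v _ => ?_
    rw [Finset.mul_sum]
    refine Finset.sum_congr rfl fun b _ => ?_
    simp only [Fin.consEquiv_apply, form, wt, Fin.sum_univ_succ, Fin.cons_zero, Fin.cons_succ,
      sgn_add]
    ring
  rw [hsplit]
  refine Finset.sum_congr rfl fun v _ => ?_
  rw [hlabel a fun k => y (k + wt v)]
  simp only [shiftOp, zero_add, add_comm 1]

/-- `shiftOp c` is the adjoint of multiplication by `1 + c z`, so this is the Krawtchouk generating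
function `(1 + 3z)^(n-i) (1 - z)^i`. The operators commute, so only the weight of `u` matters. -/
theorem charSum_eq_iterate (y : ℕ → ℤ) (u : SympVec n) :
    charSum y u = ((shiftOp (-1))^[wt u] ((shiftOp 3)^[n - wt u] y)) 0 := by
  induction n generalizing y with
  | zero => simp [charSum, wt, form, sgn]
  | succ n ih =>
    induction u using Fin.consCases with
    | cons a u =>
      have hw : wt (Fin.cons a u : SympVec (n + 1)) = labelWt a + wt u := by
        simp [wt, Fin.sum_univ_succ]
      rw [charSum_cons, ih, hw]
      have hle := wt_le u
      by_cases ha : a = 0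
      · rw [if_pos ha, labelWt, if_pos ha, zero_add, ← Function.iterate_succ_apply,
          show n + 1 - wt u = (n - wt u).succ by omega]
      · rw [if_neg ha, labelWt, if_neg ha,
          ((shiftOp_commute 3 (-1)).iterate_left _).eq, ← Function.iterate_succ_apply,
          show n + 1 - (1 + wt u) = n - wt u by omega, add_comm 1]

/-- `shiftOp` on finitely supported functions. -/
def listShift (c : ℤ) : List ℤ → List ℤ
  | [] => []
  | [a] => [a]
  | a :: b :: l => (a + c * b) :: listShift c (b :: l)

theorem listShift_getD (c : ℤ) (l : List ℤ) :
    (fun j => (listShift c l).getD j 0) = shiftOp c fun j => l.getD j 0 := by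
  funext j
  induction l generalizing j with
  | nil => simp [listShift, shiftOp]
  | cons a l ih =>
    cases l with
    | nil => cases j <;> simp [listShift, shiftOp]
    | cons b l =>
      cases j with
      | zero => simp [listShift, shiftOp]
      | succ j => simpa [listShift, shiftOp] using ih j

theorem iterate_listShift_getD (c : ℤ) (k : ℕ) (l : List ℤ) :
    (fun j => ((listShift c)^[k] l).getD j 0) = (shiftOp c)^[k] fun j => l.getD j 0 := by
  induction k generalizing l with
  | zero => rfl
  | succ k ih => rw [Function.iterate_succ_apply, ih, listShift_getD, Function.iterate_succ_apply]

/-- The value of `charSum` on vectors of weight `i`, for finitely supported `y`. -/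
def krawtchouk (n : ℕ) (l : List ℤ) (i : ℕ) : ℤ :=
  ((listShift (-1))^[i] ((listShift 3)^[n - i] l)).getD 0 0

theorem charSum_getD (l : List ℤ) (u : SympVec n) :
    charSum (fun j => l.getD j 0) u = krawtchouk n l (wt u) := by
  rw [charSum_eq_iterate, ← iterate_listShift_getD, ← iterate_listShift_getD]
  rfl

/-! ### Self-orthogonal additive codes -/

/-- Additive codes of the given size that are contained in their symplectic dual and such that
all dual vectors outside the code have weight at least `d`. -/
structure IsSelfOrthogonal (C : AddSubgroup (SympVec n)) (N d : ℕ) : Prop where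
  card : Nat.card C = N
  form_eq_zero : ∀ u ∈ C, ∀ v ∈ C, form u v = 0
  le_wt : ∀ v, (∀ u ∈ C, form u v = 0) → v ∉ C → d ≤ wt v

/-- The MacWilliams identity combined with the distance condition. -/
theorem IsSelfOrthogonal.sum_charSum_nonneg {C : AddSubgroup (SympVec n)} [Fintype C] {N d : ℕ}
    (h : IsSelfOrthogonal C N d) (y : ℕ → ℤ) (hy : ∀ j, d ≤ j → 0 ≤ y j) :
    0 ≤ ∑ u : C, (charSum y (u : SympVec n) - N * y (wt (u : SympVec n))) := by
  classical
  have hN : (Fintype.card C : ℤ) = N := by rw [← h.card, Nat.card_eq_fintype_card]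
  -- By character orthogonality the expression is `N * y (wt v)` for dual `v` outside `C`, and zero
  -- for all other `v`.
  have key : ∀ v : SympVec n, 0 ≤ (∑ u : C, sgn (form u v)) * y (wt v)
      - if v ∈ C then N * y (wt v) else 0 := by
    intro v
    rcases sum_sgn (fun u : C => form u v) fun a b => form_add_left _ _ _ with ⟨h0, hs⟩ | ⟨h0, hs⟩
    · rw [hs, hN]
      split_ifs with hv
      · simp
      · rw [sub_zero]
        exact mul_nonneg (by positivity) (hy _ (h.le_wt v (fun u hu => h0 ⟨u, hu⟩) hv))
    · rw [hs, if_neg]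
      · simp
      · obtain ⟨u, hu⟩ := h0
        exact fun hv => hu (h.form_eq_zero u u.2 v hv)
  have hsum : ∑ u : C, (charSum y (u : SympVec n) - N * y (wt (u : SympVec n))) =
      ∑ v : SympVec n, ((∑ u : C, sgn (form u v)) * y (wt v)
        - if v ∈ C then N * y (wt v) else 0) := by
    rw [Finset.sum_sub_distrib, Finset.sum_sub_distrib, ← Finset.sum_filter]
    congr 1
    · simp only [charSum, Finset.sum_mul]
      exact Finset.sum_comm
    · exact (Finset.sum_subtype _ (by simp) fun v => (N : ℤ) * y (wt v)).symm
  rw [hsum]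
  exact Finset.sum_nonneg fun v _ => key v

theorem IsSelfOrthogonal.wt_add {C : AddSubgroup (SympVec n)} {N d : ℕ}
    (h : IsSelfOrthogonal C N d) (u v : C) :
    (wt ((u + v : C) : SympVec n) : ZMod 2) = wt (u : SympVec n) + wt (v : SympVec n) := by
  rw [AddSubgroup.coe_add, SympVec.wt_add, h.form_eq_zero u u.2 v v.2, add_zero]

/-- Nonnegativity of the shadow enumerator. -/
theorem IsSelfOrthogonal.sum_shadow_nonneg {C : AddSubgroup (SympVec n)} [Fintype C] {N d : ℕ}
    (h : IsSelfOrthogonal C N d) (z : ℕ → ℤ) (hz : ∀ j, 0 ≤ z j) :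
    0 ≤ ∑ u : C, sgn (wt (u : SympVec n)) * charSum z (u : SympVec n) := by
  have hsum : ∑ u : C, sgn (wt (u : SympVec n)) * charSum z (u : SympVec n) =
      ∑ v : SympVec n, (∑ u : C, sgn (wt (u : SympVec n) + form u v)) * z (wt v) := by
    simp only [charSum, Finset.sum_mul, Finset.mul_sum, sgn_add, mul_assoc]
    exact Finset.sum_comm
  rw [hsum]
  refine Finset.sum_nonneg fun v _ => mul_nonneg ?_ (hz _)
  -- The exponent is additive in `u`, so the character sum is `|C|` or 0.
  rcases sum_sgn (fun u : C => (wt (u : SympVec n) : ZMod 2) + form u v) fun a b => by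
    rw [h.wt_add, AddSubgroup.coe_add, form_add_left]; ring with ⟨_, hs⟩ | ⟨_, hs⟩ <;> rw [hs]
  positivity

/-- A self-orthogonal code is even, or half of its words have even weight. -/
theorem IsSelfOrthogonal.even_or_sum_eq_zero {C : AddSubgroup (SympVec n)} [Fintype C] {N d : ℕ}
    (h : IsSelfOrthogonal C N d) :
    (∀ u ∈ C, Even (wt u)) ∨ ∑ u : C, sgn (wt (u : SympVec n)) = 0 := by
  rcases sum_sgn (fun u : C => (wt (u : SympVec n) : ZMod 2)) h.wt_add with ⟨h0, _⟩ | ⟨_, hs⟩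
  · exact Or.inl fun u hu => (ZMod.natCast_eq_zero_iff_even).mp (h0 ⟨u, hu⟩)
  · exact Or.inr hs

/-! ### Weights modulo four in even codes -/

/-- The sixteen arguments are the image of an affine map from a 4-dimensional cube to a
2-dimensional space, so every label is hit a multiple of four times. -/
theorem labelWt_cube_sum (x a b c e : ZMod 2 × ZMod 2) :
    4 ∣ (((labelWt (x + e + c + b + a) + labelWt (x + e + c + b)) +
      (labelWt (x + e + c + a) + labelWt (x + e + c))) +
      ((labelWt (x + e + b + a) + labelWt (x + e + b)) +
      (labelWt (x + e + a) + labelWt (x + e)))) +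
      (((labelWt (x + c + b + a) + labelWt (x + c + b)) +
      (labelWt (x + c + a) + labelWt (x + c))) +
      ((labelWt (x + b + a) + labelWt (x + b)) +
      (labelWt (x + a) + labelWt x))) := by
  revert x a b c e
  decide +kernel

/-- Fourfold differences sum over 4-cubes, where the total weight is divisible by four; halving
makes it even. The summand 1 makes the support the words of weight divisible by four. -/
theorem boolDegLE_half_wt (C : AddSubgroup (SympVec n)) (h : ∀ u ∈ C, Even (wt u)) :
    BoolDegLE 3 fun u : C => 1 + ((wt (u : SympVec n) / 2 : ℕ) : ZMod 2) := by
  intro a b c e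
  funext x
  obtain ⟨q, hq⟩ : ∃ q : C → ℕ, ∀ u : C, wt (u : SympVec n) / 2 = q u := ⟨_, fun _ => rfl⟩
  have hw : ∀ u : C, wt (u : SympVec n) = 2 * q u := fun u => by
    rw [← hq, Nat.two_mul_div_two_of_even (h u u.2)]
  have h4 : 4 ∣ (((wt (↑(x + e + c + b + a) : SympVec n) + wt (↑(x + e + c + b) : SympVec n)) +
      (wt (↑(x + e + c + a) : SympVec n) + wt (↑(x + e + c) : SympVec n))) +
      ((wt (↑(x + e + b + a) : SympVec n) + wt (↑(x + e + b) : SympVec n)) +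
      (wt (↑(x + e + a) : SympVec n) + wt (↑(x + e) : SympVec n)))) +
      (((wt (↑(x + c + b + a) : SympVec n) + wt (↑(x + c + b) : SympVec n)) +
      (wt (↑(x + c + a) : SympVec n) + wt (↑(x + c) : SympVec n))) +
      ((wt (↑(x + b + a) : SympVec n) + wt (↑(x + b) : SympVec n)) +
      (wt (↑(x + a) : SympVec n) + wt (↑x : SympVec n)))) := by
    simp only [wt, ← Finset.sum_add_distrib, AddSubgroup.coe_add, Pi.add_apply]
    exact Finset.dvd_sum fun j _ => labelWt_cube_sum _ _ _ _ _
  simp only [boolDiff, Pi.zero_apply, hq]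
  simp only [hw, ← mul_add] at h4
  have h2 := (ZMod.natCast_eq_zero_iff _ 2).mpr (Nat.dvd_of_mul_dvd_mul_left two_pos h4)
  push_cast at h2
  -- The sixteen constants 1 add up to `8 * 2 = 0`.
  linear_combination h2 + 8 * CharTwo.two_eq_zero (R := ZMod 2)

/-- In an even additive code, at least an eighth of the words have weight divisible by four. -/
theorem sum_four_dvd_nonneg (C : AddSubgroup (SympVec n)) [Fintype C]
    (h : ∀ u ∈ C, Even (wt u)) :
    0 ≤ ∑ u : C, if 4 ∣ wt (u : SympVec n) then (7 : ℤ) else -1 := by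
  -- The zero word shows that the function is not identically zero.
  have hle := (boolDegLE_half_wt C h).card_le 3 _ (Function.ne_iff.mpr ⟨0, by simp [wt_zero]⟩)
  have hiff : ∀ u : C, (1 + ((wt (u : SympVec n) / 2 : ℕ) : ZMod 2) ≠ 0) ↔
      4 ∣ wt (u : SympVec n) := by
    intro u
    have h1 : ∀ a : ZMod 2, 1 + a ≠ 0 ↔ a = 0 := by decide
    rw [h1, ZMod.natCast_eq_zero_iff]
    have := h u u.2
    rw [Nat.even_iff] at this
    omega
  simp only [hiff] at hle
  have hs : ∑ u : C, (if 4 ∣ wt (u : SympVec n) then (7 : ℤ) else -1) =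
      ∑ u : C, (8 * (if 4 ∣ wt (u : SympVec n) then 1 else 0) - 1) :=
    Finset.sum_congr rfl fun u _ => by split_ifs <;> norm_num
  rw [hs, Finset.sum_sub_distrib, ← Finset.mul_sum, Finset.sum_boole, Finset.sum_const,
    Finset.card_univ]
  simp only [nsmul_eq_mul, mul_one]
  have hle' := (Nat.cast_le (α := ℤ)).mpr hle
  push_cast at hle'
  linarith

/-- The average of `sum_four_dvd_nonneg` over the subcodes vanishing at a coordinate. -/
theorem sum_four_dvd_mul_nonneg (C : AddSubgroup (SympVec n)) [Fintype C]
    (h : ∀ u ∈ C, Even (wt u)) :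
    0 ≤ ∑ u : C, (if 4 ∣ wt (u : SympVec n) then (7 : ℤ) else -1) *
      (n - wt (u : SympVec n)) := by
  classical
  have hcoord : ∀ j : Fin n, 0 ≤ ∑ u : C, if (u : SympVec n) j = 0 then
      (if 4 ∣ wt (u : SympVec n) then (7 : ℤ) else -1) else 0 := by
    intro j
    let H : AddSubgroup (SympVec n) := C ⊓ (Pi.evalAddMonoidHom _ j).ker
    have hH : ∀ u, u ∈ H ↔ u ∈ C ∧ u j = 0 := fun u => Iff.rfl
    let f : SympVec n → ℤ := fun u => if 4 ∣ wt u then 7 else -1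
    have h1 : ∑ u : H, f u = ∑ u ∈ Finset.univ.filter (· ∈ H), f u :=
      (Finset.sum_subtype _ (by simp) f).symm
    have h2 : ∑ u : C, (if (u : SympVec n) j = 0 then f u else 0) =
        ∑ u ∈ Finset.univ.filter (· ∈ C), if u j = 0 then f u else 0 :=
      (Finset.sum_subtype _ (by simp) fun u : SympVec n => if u j = 0 then f u else 0).symm
    have h3 := sum_four_dvd_nonneg H fun u hu => h u hu.1
    change 0 ≤ ∑ u : C, (if (u : SympVec n) j = 0 then f u else 0)
    rw [h2, ← Finset.sum_filter, Finset.filter_filter]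
    simp only [← hH]
    rw [← h1]
    exact h3
  have hsum : ∑ u : C, (if 4 ∣ wt (u : SympVec n) then (7 : ℤ) else -1) *
      (n - wt (u : SympVec n)) = ∑ j : Fin n, ∑ u : C, if (u : SympVec n) j = 0 then
      (if 4 ∣ wt (u : SympVec n) then (7 : ℤ) else -1) else 0 := by
    rw [Finset.sum_comm]
    refine Finset.sum_congr rfl fun u _ => ?_
    have hn : (n : ℤ) - wt (u : SympVec n) =
        ∑ j : Fin n, if (u : SympVec n) j = 0 then (1 : ℤ) else 0 := by
      have : (n : ℤ) = ∑ _j : Fin n, 1 := by simp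
      rw [this, wt, Nat.cast_sum, ← Finset.sum_sub_distrib]
      refine Finset.sum_congr rfl fun j _ => ?_
      unfold labelWt
      split_ifs <;> simp
    rw [hn, Finset.mul_sum]
    exact Finset.sum_congr rfl fun j _ => by split_ifs <;> simp
  rw [hsum]
  exact Finset.sum_nonneg fun j _ => hcoord j

/-! ### Linear programming -/

/-- Weak duality: the zero word, always in `C`, makes the sum strictly negative. -/
theorem not_sum_nonneg (C : AddSubgroup (SympVec n)) [Fintype C] (g : ℕ → ℤ)
    (hg : ∀ u ∈ C, g (wt u) ≤ 0) (h0 : g 0 < 0) (hs : 0 ≤ ∑ u : C, g (wt (u : SympVec n))) :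
    False := by
  refine hs.not_gt (Finset.sum_neg' (fun u _ => hg u u.2) ⟨0, Finset.mem_univ _, ?_⟩)
  rwa [AddSubgroup.coe_zero, wt_zero]

/-- A dual certificate that excludes even codes. -/
theorem IsSelfOrthogonal.not_even {C : AddSubgroup (SympVec n)} {N d : ℕ}
    (h : IsSelfOrthogonal C N d) (y : List ℤ) (s t : ℕ) (hy : y.length ≤ d)
    (hcert : ∀ i ≤ n, Even i → krawtchouk n y i - N * y.getD i 0 +
      (if 4 ∣ i then 7 else -1) * (s + t * (n - i)) ≤ 0)
    (h0 : krawtchouk n y 0 - N * y.getD 0 0 + 7 * (s + t * n) < 0) :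
    ¬ ∀ u ∈ C, Even (wt u) := by
  intro heven
  have := Fintype.ofFinite C
  refine not_sum_nonneg C (fun i => krawtchouk n y i - N * y.getD i 0 +
      (if 4 ∣ i then 7 else -1) * (s + t * (n - i)))
    (fun u hu => hcert _ (wt_le u) (heven u hu)) (by simpa using h0) ?_
  -- The multipliers vanish from index `d` on, so those below `d` may have any sign.
  have h1 := h.sum_charSum_nonneg (fun j => y.getD j 0) fun j hj => by
    rw [List.getD_eq_default _ _ (hy.trans hj)]
  have h2 := mul_nonneg (Int.natCast_nonneg s) (sum_four_dvd_nonneg C heven)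
  have h3 := mul_nonneg (Int.natCast_nonneg t) (sum_four_dvd_mul_nonneg C heven)
  rw [Finset.mul_sum] at h2 h3
  simp only [charSum_getD] at h1
  refine (add_nonneg h1 (add_nonneg h2 h3)).trans_eq ?_
  rw [← Finset.sum_add_distrib, ← Finset.sum_add_distrib]
  exact Finset.sum_congr rfl fun u _ => by ring

/-- A dual certificate that forces codes to be even. -/
theorem IsSelfOrthogonal.even {C : AddSubgroup (SympVec n)} {N d : ℕ}
    (h : IsSelfOrthogonal C N d) (y z : List ℤ) (t : ℤ) (hy : y.length ≤ d)
    (hz : ∀ a ∈ z, 0 ≤ a)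
    (hcert : ∀ i ≤ n, krawtchouk n y i - N * y.getD i 0 +
      (if Even i then 1 else -1) * (krawtchouk n z i + t) ≤ 0)
    (h0 : krawtchouk n y 0 - N * y.getD 0 0 + (krawtchouk n z 0 + t) < 0) :
    ∀ u ∈ C, Even (wt u) := by
  have := Fintype.ofFinite C
  refine h.even_or_sum_eq_zero.resolve_right fun hzero => ?_
  refine not_sum_nonneg C (fun i => krawtchouk n y i - N * y.getD i 0 +
      (if Even i then 1 else -1) * (krawtchouk n z i + t))
    (fun u _ => hcert _ (wt_le u)) (by simpa using h0) ?_
  have h1 := h.sum_charSum_nonneg (fun j => y.getD j 0) fun j hj => by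
    rw [List.getD_eq_default _ _ (hy.trans hj)]
  have h2 := h.sum_shadow_nonneg (fun j => z.getD j 0) fun j => by
    rcases lt_or_ge j z.length with hj | hj
    · rw [List.getD_eq_getElem _ _ hj]
      exact hz _ (List.getElem_mem hj)
    · rw [List.getD_eq_default _ _ hj]
  -- This constraint is an equality, so `t` may be negative.
  have h3 : 0 ≤ t * ∑ u : C, sgn (wt (u : SympVec n)) := by rw [hzero, mul_zero]
  rw [Finset.mul_sum] at h3
  simp only [charSum_getD] at h1 h2
  refine (add_nonneg h1 (add_nonneg h2 h3)).trans_eq ?_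
  rw [← Finset.sum_add_distrib, ← Finset.sum_add_distrib]
  refine Finset.sum_congr rfl fun u _ => ?_
  simp only [sgn, ZMod.natCast_eq_zero_iff_even]
  ring

/-- The integers are dual solutions of the linear programs, checked weight by weight. Here the
unaveraged divisibility inequality (`s = 64`, `t = 0`) suffices. -/
theorem not_isSelfOrthogonal_27 {C : AddSubgroup (SympVec 27)} {d : ℕ} (hd : 5 ≤ d) :
    ¬ IsSelfOrthogonal C (2 ^ 12) d := fun h =>
  h.not_even [-380, -26, -18, -2, -1] 64 0 hd (by decide +kernel) (by decide +kernel)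
    (h.even [-1128, -78, -58, -6, -3] [0, 0, 20] (-60) hd (by decide) (by decide +kernel)
      (by decide +kernel))

/-- Here the certificate against even codes uses the averaged inequality instead (`s = 0`, `t =
256`). -/
theorem not_isSelfOrthogonal_28 {C : AddSubgroup (SympVec 28)} {d : ℕ} (hd : 6 ≤ d) :
    ¬ IsSelfOrthogonal C (2 ^ 14) d := fun h =>
  h.not_even [-10640, -1082, -520, -104, -32, -5] 0 256 hd (by decide +kernel) (by decide +kernel)
    (h.even [-420336, -54306, -22696, -5016, -1344, -225] [0, 8190, 6680, 1320, 0, 15] (-45360) hd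
      (by decide) (by decide +kernel) (by decide +kernel))

end SympVec

/-! ### Labels of Pauli operators -/

/-- The label of a Pauli matrix. -/
def Pauli.label : Pauli → ZMod 2 × ZMod 2
  | .I => (0, 0)
  | .X => (1, 0)
  | .Y => (1, 1)
  | .Z => (0, 1)

/-- The Pauli matrix with a given label. -/
def labelPauli (a : ZMod 2 × ZMod 2) : Pauli :=
  if a.1 = 0 then if a.2 = 0 then .I else .Z else if a.2 = 0 then .X else .Y

theorem labelPauli_label (p : Pauli) : labelPauli p.label = p := by cases p <;> decide

theorem label_labelPauli (a : ZMod 2 × ZMod 2) : (labelPauli a).label = a := by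
  revert a; decide

theorem Pauli.mat_mul_eq (p q : Pauli) :
    ∃ e : ℕ, p.mat * q.mat = Complex.I ^ e • (labelPauli (p.label + q.label)).mat := by
  have hI : Complex.I ^ 3 = -Complex.I := by
    rw [pow_succ, Complex.I_sq, neg_one_mul]
  cases p <;> cases q
  · exact ⟨0, by change _ = _ • Pauli.I.mat; simp [Pauli.mat]⟩
  · exact ⟨0, by change _ = _ • Pauli.X.mat; simp [Pauli.mat]⟩
  · exact ⟨0, by change _ = _ • Pauli.Y.mat; simp [Pauli.mat]⟩
  · exact ⟨0, by change _ = _ • Pauli.Z.mat; simp [Pauli.mat]⟩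
  · exact ⟨0, by change _ = _ • Pauli.X.mat; simp [Pauli.mat]⟩
  · exact ⟨0, by change _ = _ • Pauli.I.mat; simp [Pauli.mat]⟩
  · exact ⟨1, by change _ = _ • Pauli.Z.mat; simp [Pauli.mat]⟩
  · exact ⟨3, by change _ = _ • Pauli.Y.mat; simp [Pauli.mat, hI]⟩
  · exact ⟨0, by change _ = _ • Pauli.Y.mat; simp [Pauli.mat]⟩
  · exact ⟨3, by change _ = _ • Pauli.Z.mat; simp [Pauli.mat, hI]⟩
  · exact ⟨0, by change _ = _ • Pauli.I.mat; simp [Pauli.mat]⟩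
  · exact ⟨1, by change _ = _ • Pauli.X.mat; simp [Pauli.mat]⟩
  · exact ⟨0, by change _ = _ • Pauli.Z.mat; simp [Pauli.mat]⟩
  · exact ⟨1, by change _ = _ • Pauli.Y.mat; simp [Pauli.mat]⟩
  · exact ⟨3, by change _ = _ • Pauli.X.mat; simp [Pauli.mat, hI]⟩
  · exact ⟨0, by change _ = _ • Pauli.I.mat; simp [Pauli.mat]⟩

theorem Pauli.mat_mul_comm (p q : Pauli) :
    p.mat * q.mat = (SympVec.sgn (labelForm p.label q.label) : ℂ) • (q.mat * p.mat) := by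
  cases p <;> cases q <;>
    simp [Pauli.mat, SympVec.sgn, labelForm, Pauli.label, CharTwo.add_self_eq_zero]

namespace SympVec

variable {n : ℕ}

theorem eq_zero_of_form_eq_zero (u : SympVec n) (h : ∀ v, form u v = 0) : u = 0 := by
  have hsingle : ∀ j (a : ZMod 2 × ZMod 2), labelForm (u j) a = 0 := by
    intro j a
    rw [← h (Pi.single j a), form, Finset.sum_eq_single j]
    · rw [Pi.single_eq_same]
    · intro k _ hk
      rw [Pi.single_eq_of_ne hk]
      simp [labelForm]
    · simp
  funext j
  have h1 := hsingle j (1, 0)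
  have h2 := hsingle j (0, 1)
  simp only [labelForm, mul_zero, mul_one, zero_add, add_zero] at h1 h2
  exact Prod.ext h2 h1

theorem sgn_sum {ι : Type*} (s : Finset ι) (f : ι → ZMod 2) :
    sgn (∑ j ∈ s, f j) = ∏ j ∈ s, sgn (f j) := by
  classical
  induction s using Finset.induction_on with
  | empty => simp [sgn]
  | insert a s ha ih => rw [Finset.sum_insert ha, Finset.prod_insert ha, sgn_add, ih]

theorem sgn_injective : Function.Injective sgn := by
  intro a b; revert a b; decide

/-- The Pauli operator with a given label vector. -/
noncomputable def op (v : SympVec n) : QubitOp n := pauliOp fun j => labelPauli (v j)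

theorem op_zero : op (0 : SympVec n) = 1 := pauliOp_I

theorem op_label (p : Fin n → Pauli) : op (fun j => (p j).label) = pauliOp p := by
  simp only [op, labelPauli_label]

theorem op_mul_self (v : SympVec n) : op v * op v = 1 := pauliOp_mul_self _

theorem op_mul (u v : SympVec n) : ∃ e : ℕ, op u * op v = Complex.I ^ e • op (u + v) := by
  choose e h using fun j => Pauli.mat_mul_eq (labelPauli (u j)) (labelPauli (v j))
  refine ⟨∑ j, e j, ?_⟩
  simp only [op, pauliOp, tensorOp_mul, h, tensorOp_smul, Finset.prod_pow_eq_pow_sum,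
    label_labelPauli, Pi.add_apply]

theorem op_mul_comm (u v : SympVec n) :
    op u * op v = (sgn (form u v) : ℂ) • (op v * op u) := by
  simp only [op, pauliOp, tensorOp_mul]
  rw [show (fun j => (labelPauli (u j)).mat * (labelPauli (v j)).mat) =
    fun j => (sgn (labelForm (u j) (v j)) : ℂ) • ((labelPauli (v j)).mat * (labelPauli (u j)).mat)
    from funext fun j => by rw [Pauli.mat_mul_comm, label_labelPauli, label_labelPauli],
    tensorOp_smul, form, sgn_sum, Int.cast_prod]

/-- `g` is the Pauli operator with label vector `v`, up to a phase. -/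
def HasLabel (g : (QubitOp n)ˣ) (v : SympVec n) : Prop :=
  ∃ e : ℕ, (g : QubitOp n) = Complex.I ^ e • op v

theorem HasLabel.one : HasLabel (1 : (QubitOp n)ˣ) 0 := ⟨0, by simp [op_zero]⟩

theorem HasLabel.mul {g h : (QubitOp n)ˣ} {u v : SympVec n} (hg : HasLabel g u)
    (hh : HasLabel h v) : HasLabel (g * h) (u + v) := by
  obtain ⟨e, hg⟩ := hg
  obtain ⟨f, hh⟩ := hh
  obtain ⟨s, hs⟩ := op_mul u v
  refine ⟨e + f + s, ?_⟩
  rw [Units.val_mul, hg, hh, smul_mul_smul_comm, hs, smul_smul, pow_add, pow_add]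

theorem HasLabel.inv {g : (QubitOp n)ˣ} {u : SympVec n} (hg : HasLabel g u) :
    HasLabel g⁻¹ u := by
  obtain ⟨e, hg⟩ := hg
  refine ⟨3 * e, Units.inv_eq_of_mul_eq_one_right ?_⟩
  rw [hg, smul_mul_smul_comm, op_mul_self, ← pow_add,
    show e + 3 * e = 4 * e by ring, pow_mul, Complex.I_pow_four, one_pow, one_smul]

theorem exists_hasLabel (v : SympVec n) : ∃ g : (QubitOp n)ˣ, HasLabel g v :=
  ⟨⟨op v, op v, op_mul_self v, op_mul_self v⟩, 0, by simp⟩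

theorem mem_pauliGroup_iff {g : (QubitOp n)ˣ} : g ∈ pauliGroup n ↔ ∃ v, HasLabel g v := by
  constructor
  · rintro ⟨e, p, h⟩
    exact ⟨fun j => (p j).label, e, by rw [op_label, h]⟩
  · rintro ⟨v, e, h⟩
    exact ⟨e, _, h⟩

theorem HasLabel.mul_comm_sgn {g h : (QubitOp n)ˣ} {u v : SympVec n} (hg : HasLabel g u)
    (hh : HasLabel h v) :
    ((g * h : (QubitOp n)ˣ) : QubitOp n) =
      (sgn (form u v) : ℂ) • ((h * g : (QubitOp n)ˣ) : QubitOp n) := by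
  obtain ⟨e, hg⟩ := hg
  obtain ⟨f, hh⟩ := hh
  rw [Units.val_mul, Units.val_mul, hg, hh, smul_mul_smul_comm, smul_mul_smul_comm, op_mul_comm,
    smul_smul, smul_smul]
  congr 1
  ring

theorem smul_unit_injective {g : (QubitOp n)ˣ} {a b : ℂ}
    (h : a • (g : QubitOp n) = b • (g : QubitOp n)) : a = b := smul_left_injective ℂ g.ne_zero h

theorem HasLabel.mul_comm_iff {g h : (QubitOp n)ˣ} {u v : SympVec n} (hg : HasLabel g u)
    (hh : HasLabel h v) : g * h = h * g ↔ form u v = 0 := by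
  rw [Units.ext_iff, hg.mul_comm_sgn hh]
  constructor
  · intro H
    have h1 : (sgn (form u v) : ℂ) = ((sgn 0 : ℤ) : ℂ) :=
      smul_unit_injective (H.trans (by simp [sgn]))
    exact sgn_injective (Int.cast_injective h1)
  · intro H
    simp [H, sgn]

/-- The commutation signs with all Pauli operators determine the label, since the form is
nondegenerate. -/
theorem HasLabel.unique {g : (QubitOp n)ˣ} {u v : SympVec n} (hu : HasLabel g u)
    (hv : HasLabel g v) : u = v := by
  rw [← sub_eq_zero, ZModModule.sub_eq_add]
  refine eq_zero_of_form_eq_zero _ fun w => ?_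
  obtain ⟨h, hw⟩ := exists_hasLabel w
  have h1 : (sgn (form u w) : ℂ) = (sgn (form v w) : ℂ) :=
    smul_unit_injective ((hu.mul_comm_sgn hw).symm.trans (hv.mul_comm_sgn hw))
  rw [form_add_left, sgn_injective (Int.cast_injective h1), CharTwo.add_self_eq_zero]

/-! ### The additive code of a stabilizer group -/

/-- The label vectors of the elements of a group of operators. -/
def labels (S : Subgroup (QubitOp n)ˣ) : AddSubgroup (SympVec n) where
  carrier := {v | ∃ g ∈ S, HasLabel g v}
  zero_mem' := ⟨1, S.one_mem, HasLabel.one⟩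
  add_mem' := by
    rintro u v ⟨g, hg, hu⟩ ⟨h, hh, hv⟩
    exact ⟨g * h, S.mul_mem hg hh, hu.mul hv⟩
  neg_mem' := by
    rintro u ⟨g, hg, hu⟩
    exact ⟨g, hg, (ZModModule.neg_eq_self u).symm ▸ hu⟩

theorem pauliWeight_labelPauli (v : SympVec n) :
    pauliWeight (fun j => labelPauli (v j)) = wt v := by
  rw [pauliWeight, Finset.card_filter, wt]
  refine Finset.sum_congr rfl fun j _ => ?_
  generalize v j = a
  revert a
  decide

theorem mem_labels_pauliPerp {S : Subgroup (QubitOp n)ˣ} (hS : S ≤ pauliGroup n) {v : SympVec n}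
    (hv : ∀ u ∈ labels S, form u v = 0) : v ∈ labels (pauliPerp S) := by
  obtain ⟨g, hg⟩ := exists_hasLabel v
  refine ⟨g, ⟨mem_pauliGroup_iff.mpr ⟨v, hg⟩, Subgroup.mem_centralizer_iff.mpr fun h hh => ?_⟩, hg⟩
  obtain ⟨u, hu⟩ := mem_pauliGroup_iff.mp (hS hh)
  exact (hu.mul_comm_iff hg).mpr (hv u ⟨h, hh, hu⟩)

theorem labels_closure {ι : Type*} {g : ι → (QubitOp n)ˣ} {c : ι → SympVec n}
    (hgc : ∀ i, HasLabel (g i) (c i)) (J : Set ι) :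
    labels (Subgroup.closure (g '' J)) = AddSubgroup.closure (c '' J) := by
  apply le_antisymm
  · rintro v ⟨h, hh, hv⟩
    obtain ⟨w, hw, hhw⟩ : ∃ w ∈ AddSubgroup.closure (c '' J), HasLabel h w := by
      clear hv
      induction hh using Subgroup.closure_induction with
      | mem x hx =>
        obtain ⟨i, hi, rfl⟩ := hx
        exact ⟨c i, AddSubgroup.subset_closure ⟨i, hi, rfl⟩, hgc i⟩
      | one => exact ⟨0, zero_mem _, HasLabel.one⟩
      | mul x y _ _ hx hy =>
        obtain ⟨a, ha, hxa⟩ := hx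
        obtain ⟨b, hb, hyb⟩ := hy
        exact ⟨a + b, add_mem ha hb, hxa.mul hyb⟩
      | inv x _ hx =>
        obtain ⟨a, ha, hxa⟩ := hx
        exact ⟨a, ha, hxa.inv⟩
    rwa [hv.unique hhw]
  · rw [AddSubgroup.closure_le]
    rintro _ ⟨i, hi, rfl⟩
    exact ⟨g i, Subgroup.subset_closure ⟨i, hi, rfl⟩, hgc i⟩

theorem closure_eq_span (X : Set (SympVec n)) :
    (AddSubgroup.closure X : Set (SympVec n)) = Submodule.span (ZMod 2) X := by
  apply Set.Subset.antisymm
  · exact (AddSubgroup.closure_le (Submodule.span (ZMod 2) X).toAddSubgroup).mpr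
      Submodule.subset_span
  · exact (Submodule.span_le (p := AddSubgroup.toZModSubmodule 2 (AddSubgroup.closure X))).mpr
      AddSubgroup.subset_closure

/-- Elements of a stabilizer group are determined by their labels. -/
theorem eq_of_hasLabel {S : Subgroup (QubitOp n)ˣ} (hS : (-1 : (QubitOp n)ˣ) ∉ S)
    {g h : (QubitOp n)ˣ} (hg : g ∈ S) (hh : h ∈ S) {v : SympVec n} (hgv : HasLabel g v)
    (hhv : HasLabel h v) : g = h := by
  obtain ⟨e, he⟩ := hgv.mul hhv.inv
  have hk : g * h⁻¹ ∈ S := S.mul_mem hg (S.inv_mem hh)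
  rw [← mul_inv_eq_one]
  generalize g * h⁻¹ = k at he hk
  rw [ZModModule.add_self, op_zero] at he
  -- The quotient `k` is the scalar `i^e`. If it were `±i`, then `k * k = -1` would lie in `S`.
  have hsq : (Complex.I ^ e) ^ 2 = -1 → False := fun h2 => hS (by
    rw [show (-1 : (QubitOp n)ˣ) = k * k from Units.ext (by
      rw [Units.val_mul, he, smul_mul_smul_comm, ← sq, h2]; simp)]
    exact S.mul_mem hk hk)
  have h4 : (Complex.I ^ e) ^ 2 = 1 ∨ (Complex.I ^ e) ^ 2 = -1 := by
    rw [← pow_mul, mul_comm, pow_mul, Complex.I_sq]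
    exact neg_one_pow_eq_or ℂ e
  rcases h4 with h4 | h4
  · rcases eq_or_eq_neg_of_sq_eq_sq _ _ (h4.trans (one_pow 2).symm) with h1 | h1
    · exact Units.ext (by rw [he, h1]; simp)
    · exact absurd (by rwa [show (-1 : (QubitOp n)ˣ) = k from Units.ext (by rw [he, h1]; simp)]) hS
  · exact (hsq h4).elim

theorem card_labels {r : ℕ} {S : Subgroup (QubitOp n)ˣ} (h : IsStabilizerGroup n r S) :
    Nat.card (labels S) = 2 ^ r := by
  obtain ⟨g, hgS, hind⟩ := h.generators
  have hmem : ∀ i, g i ∈ S := fun i => hgS ▸ Subgroup.subset_closure ⟨i, rfl⟩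
  choose c hgc using fun i => mem_pauliGroup_iff.mp (h.le_pauliGroup (hmem i))
  -- A linear dependence of labels expresses a generator through the others up to phase;
  -- `eq_of_hasLabel` removes the phase, contradicting independence.
  have hli : LinearIndependent (ZMod 2) c := by
    rw [linearIndependent_iff_notMem_span]
    intro i hi
    rw [← SetLike.mem_coe, ← closure_eq_span, SetLike.mem_coe, ← labels_closure hgc] at hi
    obtain ⟨k, hk, hkc⟩ := hi
    have hkS : k ∈ S := by
      rw [← hgS]
      exact Subgroup.closure_mono (Set.image_subset_range _ _) hk
    refine hind i ?_
    rw [eq_of_hasLabel h.neg_one_notMem (hmem i) hkS (hgc i) hkc]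
    convert hk using 3
    ext j
    simp
  have hcard : Nat.card (labels S) = Nat.card (Submodule.span (ZMod 2) (Set.range c)) := by
    rw [← hgS, ← Set.image_univ, labels_closure hgc, ← Set.image_univ]
    exact Nat.card_congr (Equiv.setCongr (closure_eq_span _))
  rw [hcard, Module.natCard_eq_pow_finrank (K := ZMod 2), finrank_span_eq_card hli, Nat.card_zmod,
    Fintype.card_fin]

theorem isSelfOrthogonal_labels {r d : ℕ} {S : Subgroup (QubitOp n)ˣ}
    (h : IsStabilizerGroup n r S)
    (hd : d ∈ lowerBounds (pauliWeight '' (phaseFree (pauliPerp S) \ phaseFree S))) :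
    IsSelfOrthogonal (labels S) (2 ^ r) d where
  card := card_labels h
  form_eq_zero := by
    rintro u ⟨g, hg, hu⟩ v ⟨k, hk, hv⟩
    exact (hu.mul_comm_iff hv).mp (h.comm g hg k hk)
  le_wt v hv hvS := by
    rw [← pauliWeight_labelPauli]
    exact hd ⟨_, ⟨mem_labels_pauliPerp h.le_pauliGroup hv, hvS⟩, rfl⟩

end SympVec

theorem mainTheorem9 :
    (∀ d : ℕ, 5 ≤ d → ¬ ∃ Q : Submodule ℂ ((Fin 27 → Fin 2) → ℂ), IsStabilizerCode 27 15 d Q) ∧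
    (∀ d : ℕ, 6 ≤ d → ¬ ∃ Q : Submodule ℂ ((Fin 28 → Fin 2) → ℂ), IsStabilizerCode 28 14 d Q) := by
  constructor
  · rintro d hd ⟨Q, r, S, hr, hS, -, hleast⟩
    obtain rfl : r = 12 := by omega
    exact SympVec.not_isSelfOrthogonal_27 hd (SympVec.isSelfOrthogonal_labels hS hleast.2)
  · rintro d hd ⟨Q, r, S, hr, hS, -, hleast⟩
    obtain rfl : r = 14 := by omega
    exact SympVec.not_isSelfOrthogonal_28 hd (SympVec.isSelfOrthogonal_labels hS hleast.2)
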